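/- Let $W^*\in\mathbb{R}^{2\times 2}$ have entries $w^*_{11}=w^*_{22}=w^*>0$ and $w^*_{12}>0$ (its entry $w^*_{21}$ is never observed and may be arbitrary; e.g. $w^*_{21}=(w^*)^2/w^*_{12}$ if $W^*$ has rank one). For a set $\Omega$ of observed index pairs put $\ell(W;\Omega)=\frac12\sum_{(i,j)\in\Omega}(w_{ij}-w^*_{ij})^2$. A gradient flow of the depth-2 model on $[T,\infty)$ is a pair of functions $A,B:[T,\infty)\to\mathbb{R}^{2\times2}$ with $$\dot A(t)=-\tfrac{\partial}{\partial A}\,\ell(A(t)B(t);\Omega),\qquad \dot B(t)=-\tfrac{\partial}{\partial B}\,\ell(A(t)B(t);\Omega)\qquad(t\ge T).$$ Let $\Omega_{\rm pre}=\{(1,1),(2,2)\}$ and $\Omega_{\rm post}=\{(1,1),(1,2),(2,2)\}$. Write ${\rm srank}(W)=\|W\|_F^2/\|W\|_2^2$ for the stable rank, where $\|\cdot\|_F$ is the Frobenius norm and $\|\cdot\|_2$ the spectral norm. **Pre-training.** For every $\alpha>0$ and every gradient flow for $\Omega_{\rm pre}$ on $[0,\infty)$ with $A(0)=B(0)=\alpha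 I_2$, both $A(t)$ and $B(t)$ converge to $\sqrt{w^*}\,I_2$ as $t\to\infty$. **Post-training.** Let $T_1\in\mathbb{R}$ and let $(A,B)$ be a gradient flow for $\Omega_{\rm post}$ on $[T_1,\infty)$ that starts from the pre-trained factors $A(T_1)=B(T_1)=\sqrt{w^*}\,I_2$. Write $W(t)=A(t)B(t)$, with entries $w_{ij}(t)$. Then: 1. for all $t\ge T_1$, $\;\ell(W(t);\Omega_{\rm post})\le \frac12\,(w^*_{12})^2\,e^{-2w^*(t-T_1)}$; 2. the limit $W(\infty)=\lim_{t\to\infty}W(t)$ exists and ${\rm srank}(W(\infty))\ge 1+\exp\!\left(-8\,\frac{w^*_{12}}{w^*}\right)$; 3. for all $t>T_1$, $\;w_{21}(t)<0$. -/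

import Mathlib

open Filter Topology

namespace MatrixCompletion

noncomputable section

/-- The squared-error loss over the observed entries: half the sum over `Ω` of the squared
differences between the entries of `W` and those of the ground truth `Wstar`. -/
def loss {d : ℕ} (Ω : Finset (Fin d × Fin d)) (Wstar W : Matrix (Fin d) (Fin d) ℝ) : ℝ :=
  (1 / 2) * ∑ p ∈ Ω, (W p.1 p.2 - Wstar p.1 p.2) ^ 2

/-- The training objective of the depth-2 model: the loss of the product `A * B`. -/
def objective {d k : ℕ} (Ω : Finset (Fin d × Fin d)) (Wstar : Matrix (Fin d) (Fin d) ℝ)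
    (A : Matrix (Fin d) (Fin k) ℝ) (B : Matrix (Fin k) (Fin d) ℝ) : ℝ :=
  loss Ω Wstar (A * B)

/-- The gradient of a real function of a matrix: the matrix of its partial derivatives with
respect to the entries. -/
def matrixGradient {m n : ℕ} (f : Matrix (Fin m) (Fin n) ℝ → ℝ) (M : Matrix (Fin m) (Fin n) ℝ) :
    Matrix (Fin m) (Fin n) ℝ :=
  Matrix.of fun i j => deriv (fun s : ℝ => f (M + s • Matrix.single i j (1 : ℝ))) 0

/-- `(A, B)` is a gradient flow of the depth-2 objective on the time interval `[T, ∞)`: both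
factors are differentiable there (one-sidedly at `T`), with time derivative minus the partial
gradient of the objective in that factor. -/
structure IsGradientFlow {d k : ℕ} (Ω : Finset (Fin d × Fin d)) (Wstar : Matrix (Fin d) (Fin d) ℝ)
    (T : ℝ) (A : ℝ → Matrix (Fin d) (Fin k) ℝ) (B : ℝ → Matrix (Fin k) (Fin d) ℝ) : Prop where
  deriv_left : ∀ t, T ≤ t → ∀ i j, HasDerivWithinAt (fun s => A s i j)
    (-(matrixGradient (fun M => objective Ω Wstar M (B t)) (A t) i j)) (Set.Ici T) t
  deriv_right : ∀ t, T ≤ t → ∀ i j, HasDerivWithinAt (fun s => B s i j)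
    (-(matrixGradient (fun M => objective Ω Wstar (A t) M) (B t) i j)) (Set.Ici T) t

/-- The Frobenius norm. -/
def frobNorm {m n : ℕ} (W : Matrix (Fin m) (Fin n) ℝ) : ℝ :=
  Real.sqrt (∑ i, ∑ j, W i j ^ 2)

/-- The spectral norm of a square matrix: its operator norm on Euclidean space. -/
def specNorm {n : ℕ} (W : Matrix (Fin n) (Fin n) ℝ) : ℝ :=
  ‖Matrix.toEuclideanCLM (n := Fin n) (𝕜 := ℝ) W‖

/-- The stable rank: the squared ratio of the Frobenius norm to the spectral norm. -/
def stableRank {n : ℕ} (W : Matrix (Fin n) (Fin n) ℝ) : ℝ :=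
  frobNorm W ^ 2 / specNorm W ^ 2

/-- The diagonal observations of a `2 × 2` matrix. -/
def preObs : Finset (Fin 2 × Fin 2) := {(0, 0), (1, 1)}

/-- The diagonal observations together with the upper right entry. -/
def postObs : Finset (Fin 2 × Fin 2) := {(0, 0), (0, 1), (1, 1)}

end

end MatrixCompletion

/-! In pre-training the factors stay diagonal and equal, and each diagonal entry solves `y' = -(y² -
w) y`, which becomes linear in `1 / y²`.

In post-training the flow is invariant under exchanging the factors and reflecting them across the
antidiagonal, so `A = !![a, b; c, d]` and `B = !![d, b; c, a]`. The product has both diagonal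
entries `a d + b c`, observed off-diagonal entry `2 a b` and unobserved entry `2 c d`. Put `m =
w*₁₂`, `r = a d + b c - w`, `σ = 2 a b - m`, `q = b d + a c`; the unobserved entry has derivative
`-2 r q`. Balancedness `a² + c² = b² + d²` allows `a` and `d` to be expressed through `x = a + d`,
`u = b - c`, `v = b + c`. Each of these quantities, as well as `r` and `-σ`, solves a scalar linear
equation whose forcing is nonnegative as long as the others have the right sign. A continuity
argument then fixes all signs: `σ < 0`, `x > 0`, and `u, v, q, r ≥ 0`, with `r, q > 0` after the
initial time. Hence the unobserved entry becomes negative (`unobserved_neg`).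

These signs give the decay of `2 r² + σ²` at rate `2 w` (`residual_sq_le`), which makes the
decreasing unobserved entry bounded, hence convergent. The singular value ratio of each factor is
`(x + v) / (x - v)`. Its logarithm has derivative `-σ ≤ m exp(-w (t - T))`, so the ratio never
exceeds `N = exp(m / w)` (`singular_ratio_le`). Both factors have this ratio, so that of the product
is at most `N²`, and the stable rank of the limit is at least `1 + N⁻⁴`. -/

namespace MatrixCompletion

/-! ### Scalar linear comparison and continuous induction -/

/-- Comparison for the scalar linear equation `f' = g f + h` with nonnegative forcing `h`. -/
theorem exists_pos_mul_le_of_hasDerivWithinAt {f g h : ℝ → ℝ} {T S : ℝ} (hTS : T ≤ S)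
    (hg : ContinuousOn g (Set.Icc T S))
    (hf : ∀ t ∈ Set.Icc T S, HasDerivWithinAt f (g t * f t + h t) (Set.Ici T) t)
    (hh : ∀ t ∈ Set.Ioo T S, 0 ≤ h t) :
    ∃ c : ℝ, 0 < c ∧ c * f T ≤ f S ∧
      (T < S → (∀ t ∈ Set.Ioo T S, 0 < h t) → c * f T < f S) := by
  -- Extending `g` by constants beyond the interval makes the integrating factor `exp (-∫ g)`
  -- differentiable everywhere.
  set k : ℝ → ℝ := Set.IccExtend hTS ((Set.Icc T S).domRestrict g) with hk
  have hkc : Continuous k := (continuousOn_iff_continuous_domRestrict.mp hg).Icc_extend'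
  have hkg : ∀ t ∈ Set.Icc T S, k t = g t := fun t ht => Set.IccExtend_of_mem hTS _ ht
  set G : ℝ → ℝ := fun t => ∫ s in T..t, k s with hG
  have hGd : ∀ t, HasDerivAt G (k t) t := fun t =>
    intervalIntegral.integral_hasDerivAt_right (hkc.intervalIntegrable _ _)
      hkc.stronglyMeasurable.stronglyMeasurableAtFilter hkc.continuousAt
  have hGT : G T = 0 := by simp [hG]
  have hd : ∀ t ∈ Set.Icc T S, HasDerivWithinAt (fun t => f t * Real.exp (-G t))
      (h t * Real.exp (-G t)) (Set.Ici T) t := by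
    intro t ht
    refine ((hf t ht).fun_mul (hGd t).fun_neg.exp.hasDerivWithinAt).congr_deriv ?_
    rw [hkg t ht]
    ring
  have hc : ContinuousOn (fun t => f t * Real.exp (-G t)) (Set.Icc T S) := fun t ht =>
    (hd t ht).continuousWithinAt.mono Set.Icc_subset_Ici_self
  have hder : ∀ t ∈ interior (Set.Icc T S), deriv (fun t => f t * Real.exp (-G t)) t
      = h t * Real.exp (-G t) := by
    intro t ht
    rw [interior_Icc] at ht
    exact ((hd t ⟨ht.1.le, ht.2.le⟩).hasDerivAt (Ici_mem_nhds ht.1)).deriv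
  have hdiff : DifferentiableOn ℝ (fun t => f t * Real.exp (-G t)) (interior (Set.Icc T S)) := by
    intro t ht
    rw [interior_Icc] at ht
    exact ((hd t ⟨ht.1.le, ht.2.le⟩).hasDerivAt
      (Ici_mem_nhds ht.1)).differentiableAt.differentiableWithinAt
  have hS : f S * Real.exp (-G S) * Real.exp (G S) = f S := by
    rw [mul_assoc, ← Real.exp_add]
    simp
  refine ⟨Real.exp (G S), Real.exp_pos _, ?_, fun hlt hpos => ?_⟩
  · have hm := monotoneOn_of_deriv_nonneg (convex_Icc T S) hc hdiff (fun t ht => by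
      rw [hder t ht]
      rw [interior_Icc] at ht
      exact mul_nonneg (hh t ht) (Real.exp_pos _).le)
      (Set.left_mem_Icc.2 hTS) (Set.right_mem_Icc.2 hTS) hTS
    simp only [hGT, neg_zero, Real.exp_zero, mul_one] at hm
    calc Real.exp (G S) * f T ≤ Real.exp (G S) * (f S * Real.exp (-G S)) := by gcongr
      _ = f S := by rw [mul_comm, hS]
  · have hm := strictMonoOn_of_deriv_pos (convex_Icc T S) hc (fun t ht => by
      rw [hder t ht]
      rw [interior_Icc] at ht
      exact mul_pos (hpos t ht) (Real.exp_pos _))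
      (Set.left_mem_Icc.2 hTS) (Set.right_mem_Icc.2 hTS) hlt
    simp only [hGT, neg_zero, Real.exp_zero, mul_one] at hm
    calc Real.exp (G S) * f T < Real.exp (G S) * (f S * Real.exp (-G S)) := by gcongr
      _ = f S := by rw [mul_comm, hS]

section Comparison

variable {f g h : ℝ → ℝ} {T S : ℝ}

theorem nonneg_of_hasDerivWithinAt (hTS : T ≤ S) (hg : ContinuousOn g (Set.Icc T S))
    (hf : ∀ t ∈ Set.Icc T S, HasDerivWithinAt f (g t * f t + h t) (Set.Ici T) t)
    (hh : ∀ t ∈ Set.Ioo T S, 0 ≤ h t) (h0 : 0 ≤ f T) : 0 ≤ f S := by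
  obtain ⟨c, hc, hle, -⟩ := exists_pos_mul_le_of_hasDerivWithinAt hTS hg hf hh
  exact (mul_nonneg hc.le h0).trans hle

theorem pos_of_hasDerivWithinAt (hTS : T ≤ S) (hg : ContinuousOn g (Set.Icc T S))
    (hf : ∀ t ∈ Set.Icc T S, HasDerivWithinAt f (g t * f t + h t) (Set.Ici T) t)
    (hh : ∀ t ∈ Set.Ioo T S, 0 ≤ h t) (h0 : 0 < f T) : 0 < f S := by
  obtain ⟨c, hc, hle, -⟩ := exists_pos_mul_le_of_hasDerivWithinAt hTS hg hf hh
  exact (mul_pos hc h0).trans_le hle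

theorem pos_of_hasDerivWithinAt_of_forcing_pos (hTS : T < S) (hg : ContinuousOn g (Set.Icc T S))
    (hf : ∀ t ∈ Set.Icc T S, HasDerivWithinAt f (g t * f t + h t) (Set.Ici T) t)
    (hh : ∀ t ∈ Set.Ioo T S, 0 < h t) (h0 : 0 ≤ f T) : 0 < f S := by
  obtain ⟨c, hc, -, hlt⟩ := exists_pos_mul_le_of_hasDerivWithinAt hTS.le hg hf
    (fun t ht => (hh t ht).le)
  exact (mul_nonneg hc.le h0).trans_lt (hlt hTS hh)

theorem eq_zero_of_hasDerivWithinAt (hg : ContinuousOn g (Set.Ici T))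
    (hf : ∀ t, T ≤ t → HasDerivWithinAt f (g t * f t) (Set.Ici T) t) (h0 : f T = 0)
    {t : ℝ} (ht : T ≤ t) : f t = 0 := by
  have h1 : 0 ≤ f t := nonneg_of_hasDerivWithinAt (h := fun _ => 0) ht
    (hg.mono Set.Icc_subset_Ici_self)
    (fun s hs => (hf s hs.1).congr_deriv (by ring)) (fun _ _ => le_rfl) h0.ge
  have h2 : 0 ≤ -f t := nonneg_of_hasDerivWithinAt (f := fun t => -f t) (h := fun _ => 0) ht
    (hg.mono Set.Icc_subset_Ici_self)
    (fun s hs => (hf s hs.1).fun_neg.congr_deriv (by ring)) (fun _ _ => le_rfl) (by simp [h0])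
  linarith

/-- Otherwise the points of `[T, t]` with `f ≤ 0` form a nonempty compact set, and its least element
contradicts `hstep`. The initial value is covered by `hstep` at `S = T`, where its premise is
vacuous. -/
theorem pos_of_forall_Ico_pos (hf : ContinuousOn f (Set.Ici T))
    (hstep : ∀ S, T ≤ S → (∀ t ∈ Set.Ico T S, 0 < f t) → 0 < f S) {t : ℝ} (ht : T ≤ t) :
    0 < f t := by
  by_contra hneg
  have hcomp : IsCompact (Set.Icc T t ∩ f ⁻¹' Set.Iic 0) :=
    isCompact_Icc.of_isClosed_subset ((hf.mono Set.Icc_subset_Ici_self).preimage_isClosed_of_isClosed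
      isClosed_Icc isClosed_Iic) Set.inter_subset_left
  obtain ⟨S, ⟨hS, hS0⟩, hmin⟩ := hcomp.exists_isLeast ⟨t, ⟨ht, le_rfl⟩, not_lt.mp hneg⟩
  refine absurd (hstep S hS.1 fun s hs => ?_) (not_lt.mpr hS0)
  by_contra hs0
  exact absurd (hmin ⟨⟨hs.1, hs.2.le.trans hS.2⟩, not_lt.mp hs0⟩) (not_le.mpr hs.2)

end Comparison

/-! ### Gradients and the entrywise flow equations -/

theorem deriv_loss_add_smul {d : ℕ} (Ω : Finset (Fin d × Fin d))
    (Wstar X Y : Matrix (Fin d) (Fin d) ℝ) :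
    deriv (fun s : ℝ => loss Ω Wstar (X + s • Y)) 0
      = ∑ p ∈ Ω, (X p.1 p.2 - Wstar p.1 p.2) * Y p.1 p.2 := by
  have h : HasDerivAt (fun s : ℝ => loss Ω Wstar (X + s • Y))
      ((1 / 2) * ∑ p ∈ Ω, 2 * (X p.1 p.2 - Wstar p.1 p.2) * Y p.1 p.2) 0 := by
    unfold loss
    refine HasDerivAt.const_mul _ (HasDerivAt.fun_sum fun p _ => ?_)
    simp only [Matrix.add_apply, Matrix.smul_apply, smul_eq_mul]
    refine (((((hasDerivAt_id (0 : ℝ)).mul_const (Y p.1 p.2)).const_add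
      (X p.1 p.2)).sub_const (Wstar p.1 p.2)).fun_pow 2).congr_deriv ?_
    simp
  rw [h.deriv, Finset.mul_sum]
  exact Finset.sum_congr rfl fun p _ => by ring

theorem matrixGradient_objective_left {d k : ℕ} (Ω : Finset (Fin d × Fin d))
    (Wstar : Matrix (Fin d) (Fin d) ℝ) (A : Matrix (Fin d) (Fin k) ℝ)
    (B : Matrix (Fin k) (Fin d) ℝ) (i : Fin d) (j : Fin k) :
    matrixGradient (fun M => objective Ω Wstar M B) A i j
      = ∑ p ∈ Ω, ((A * B) p.1 p.2 - Wstar p.1 p.2)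
          * (Matrix.single i j (1 : ℝ) * B) p.1 p.2 := by
  simp only [matrixGradient, Matrix.of_apply, objective, Matrix.add_mul, Matrix.smul_mul]
  exact deriv_loss_add_smul _ _ _ _

theorem matrixGradient_objective_right {d k : ℕ} (Ω : Finset (Fin d × Fin d))
    (Wstar : Matrix (Fin d) (Fin d) ℝ) (A : Matrix (Fin d) (Fin k) ℝ)
    (B : Matrix (Fin k) (Fin d) ℝ) (i : Fin k) (j : Fin d) :
    matrixGradient (fun M => objective Ω Wstar A M) B i j
      = ∑ p ∈ Ω, ((A * B) p.1 p.2 - Wstar p.1 p.2)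
          * (A * Matrix.single i j (1 : ℝ)) p.1 p.2 := by
  simp only [matrixGradient, Matrix.of_apply, objective, Matrix.mul_add, Matrix.mul_smul]
  exact deriv_loss_add_smul _ _ _ _

section Entries

variable {Wstar : Matrix (Fin 2) (Fin 2) ℝ} {T : ℝ} {A B : ℝ → Matrix (Fin 2) (Fin 2) ℝ}

theorem IsGradientFlow.deriv_entries_pre (H : IsGradientFlow preObs Wstar T A B) {t : ℝ}
    (ht : T ≤ t) :
    (∀ i j, HasDerivWithinAt (fun s => A s i j)
      (-(((A t * B t) i i - Wstar i i) * B t j i)) (Set.Ici T) t) ∧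
    (∀ i j, HasDerivWithinAt (fun s => B s j i)
      (-(((A t * B t) i i - Wstar i i) * A t i j)) (Set.Ici T) t) := by
  refine ⟨fun i j => (H.deriv_left t ht i j).congr_deriv ?_,
    fun i j => (H.deriv_right t ht j i).congr_deriv ?_⟩
  · rw [matrixGradient_objective_left]
    fin_cases i <;> fin_cases j <;> simp [preObs, Matrix.mul_apply, Fin.sum_univ_two, Matrix.single]
  · rw [matrixGradient_objective_right]
    fin_cases i <;> fin_cases j <;> simp [preObs, Matrix.mul_apply, Fin.sum_univ_two, Matrix.single]

theorem IsGradientFlow.deriv_entries_post (H : IsGradientFlow postObs Wstar T A B) {t : ℝ}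
    (ht : T ≤ t) :
    (∀ j, HasDerivWithinAt (fun s => A s 0 j)
      (-(((A t * B t) 0 0 - Wstar 0 0) * B t j 0 + ((A t * B t) 0 1 - Wstar 0 1) * B t j 1))
      (Set.Ici T) t) ∧
    (∀ j, HasDerivWithinAt (fun s => A s 1 j)
      (-(((A t * B t) 1 1 - Wstar 1 1) * B t j 1)) (Set.Ici T) t) ∧
    (∀ j, HasDerivWithinAt (fun s => B s j 0)
      (-(((A t * B t) 0 0 - Wstar 0 0) * A t 0 j)) (Set.Ici T) t) ∧
    (∀ j, HasDerivWithinAt (fun s => B s j 1)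
      (-(((A t * B t) 0 1 - Wstar 0 1) * A t 0 j + ((A t * B t) 1 1 - Wstar 1 1) * A t 1 j))
      (Set.Ici T) t) := by
  refine ⟨fun j => (H.deriv_left t ht 0 j).congr_deriv ?_,
    fun j => (H.deriv_left t ht 1 j).congr_deriv ?_,
    fun j => (H.deriv_right t ht j 0).congr_deriv ?_,
    fun j => (H.deriv_right t ht j 1).congr_deriv ?_⟩
  · rw [matrixGradient_objective_left]
    fin_cases j <;> simp [postObs, Matrix.mul_apply, Fin.sum_univ_two, Matrix.single]
  · rw [matrixGradient_objective_left]
    fin_cases j <;> simp [postObs, Matrix.mul_apply, Fin.sum_univ_two, Matrix.single]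
  · rw [matrixGradient_objective_right]
    fin_cases j <;> simp [postObs, Matrix.mul_apply, Fin.sum_univ_two, Matrix.single]
  · rw [matrixGradient_objective_right]
    fin_cases j <;> simp [postObs, Matrix.mul_apply, Fin.sum_univ_two, Matrix.single]

end Entries

/-! ### Pre-training -/

/-- Solutions of `y' = -(y² - w) y` with a positive initial value converge to `√w`, since
`1 / y² - 1 / w` solves a linear equation. -/
theorem tendsto_sqrt_of_hasDerivWithinAt {w T : ℝ} (hw : 0 < w) {y : ℝ → ℝ}
    (hy : ∀ t, T ≤ t → HasDerivWithinAt y (-((y t * y t - w) * y t)) (Set.Ici T) t)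
    (h0 : 0 < y T) : Tendsto y atTop (𝓝 (Real.sqrt w)) := by
  have hc : ContinuousOn y (Set.Ici T) := fun t ht => (hy t ht).continuousWithinAt
  have hpos : ∀ t, T ≤ t → 0 < y t := fun t ht =>
    pos_of_hasDerivWithinAt (g := fun t => -(y t * y t - w)) (h := fun _ => 0) ht
      ((((hc.mul hc).sub continuousOn_const).neg).mono Set.Icc_subset_Ici_self)
      (fun s hs => (hy s hs.1).congr_deriv (by ring)) (fun _ _ => le_rfl) h0
  set C : ℝ := (y T ^ 2)⁻¹ - w⁻¹ with hC
  have hsol : ∀ t, T ≤ t → (y t ^ 2)⁻¹ - w⁻¹ - C * Real.exp (-2 * w * (t - T)) = 0 := by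
    intro t ht
    refine eq_zero_of_hasDerivWithinAt (T := T)
      (f := fun t => (y t ^ 2)⁻¹ - w⁻¹ - C * Real.exp (-2 * w * (t - T)))
      (g := fun _ => -2 * w) continuousOn_const (fun s hs => ?_) (by simp [hC]) ht
    have hne := (hpos s hs).ne'
    have hE : HasDerivWithinAt (fun t => Real.exp (-2 * w * (t - T)))
        (Real.exp (-2 * w * (s - T)) * (-2 * w * 1)) (Set.Ici T) s :=
      ((((hasDerivAt_id s).sub_const T).const_mul (-2 * w)).exp).hasDerivWithinAt
    refine ((((hy s hs).fun_pow 2).fun_inv (pow_ne_zero 2 hne)).sub_const w⁻¹ |>.fun_sub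
      (hE.const_mul C)).congr_deriv ?_
    field_simp
    ring
  have hlim : Tendsto (fun t => w⁻¹ + C * Real.exp (-2 * w * (t - T))) atTop
      (𝓝 (w⁻¹ + C * 0)) := by
    refine tendsto_const_nhds.add (Tendsto.const_mul C (Real.tendsto_exp_atBot.comp ?_))
    exact (tendsto_atTop_add_const_right _ (-T) tendsto_id).const_mul_atTop_of_neg (by linarith)
  rw [mul_zero, add_zero] at hlim
  have h3 := (hlim.inv₀ (inv_ne_zero hw.ne')).sqrt
  rw [inv_inv] at h3
  refine h3.congr' ?_
  filter_upwards [eventually_ge_atTop T] with t ht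
  have : w⁻¹ + C * Real.exp (-2 * w * (t - T)) = (y t ^ 2)⁻¹ := by linarith [hsol t ht]
  rw [this, inv_inv, Real.sqrt_sq (hpos t ht).le]

/-- The entries of `A - Bᵀ`, and then the off-diagonal entries of `A`, solve homogeneous linear
equations with zero initial value. What remains is one scalar equation per diagonal entry. -/
theorem IsGradientFlow.tendsto_pre {Wstar : Matrix (Fin 2) (Fin 2) ℝ} {w : ℝ} (hw : 0 < w)
    (hdiag : ∀ i, Wstar i i = w) {T α : ℝ} (hα : 0 < α) {A B : ℝ → Matrix (Fin 2) (Fin 2) ℝ}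
    (H : IsGradientFlow preObs Wstar T A B) (hA : A T = α • (1 : Matrix (Fin 2) (Fin 2) ℝ))
    (hB : B T = α • (1 : Matrix (Fin 2) (Fin 2) ℝ)) :
    Tendsto A atTop (𝓝 (Real.sqrt w • (1 : Matrix (Fin 2) (Fin 2) ℝ))) ∧
    Tendsto B atTop (𝓝 (Real.sqrt w • (1 : Matrix (Fin 2) (Fin 2) ℝ))) := by
  have hdA : ∀ i j t, T ≤ t → HasDerivWithinAt (fun s => A s i j)
      (-(((A t * B t) i i - Wstar i i) * B t j i)) (Set.Ici T) t :=
    fun i j t ht => (H.deriv_entries_pre ht).1 i j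
  have hdB : ∀ i j t, T ≤ t → HasDerivWithinAt (fun s => B s j i)
      (-(((A t * B t) i i - Wstar i i) * A t i j)) (Set.Ici T) t :=
    fun i j t ht => (H.deriv_entries_pre ht).2 i j
  have hcA : ∀ i j, ContinuousOn (fun s => A s i j) (Set.Ici T) :=
    fun i j t ht => (hdA i j t ht).continuousWithinAt
  have hcB : ∀ i j, ContinuousOn (fun s => B s j i) (Set.Ici T) :=
    fun i j t ht => (hdB i j t ht).continuousWithinAt
  have hcR : ∀ i, ContinuousOn (fun s => (A s * B s) i i - Wstar i i) (Set.Ici T) := by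
    intro i
    simp only [Matrix.mul_apply]
    exact (continuousOn_finsetSum _ fun j _ => (hcA i j).mul (hcB i j)).sub continuousOn_const
  have hsymm : ∀ i j t, T ≤ t → B t j i = A t i j := by
    intro i j t ht
    refine (sub_eq_zero.mp (eq_zero_of_hasDerivWithinAt (f := fun t => A t i j - B t j i)
      (hcR i) (fun s hs => ((hdA i j s hs).fun_sub (hdB i j s hs)).congr_deriv (by ring)) ?_ ht)).symm
    fin_cases i <;> fin_cases j <;> simp [hA, hB]
  have hoff : ∀ i j t, i ≠ j → T ≤ t → A t i j = 0 := by
    intro i j t hij ht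
    refine eq_zero_of_hasDerivWithinAt (f := fun t => A t i j) (hcR i).neg
      (fun s hs => (hdA i j s hs).congr_deriv (by rw [hsymm i j s hs]; simp; ring)) ?_ ht
    simp [hA, hij]
  have hdiagA : ∀ i, Tendsto (fun t => A t i i) atTop (𝓝 (Real.sqrt w)) := by
    intro i
    refine tendsto_sqrt_of_hasDerivWithinAt hw (T := T)
      (fun t ht => (hdA i i t ht).congr_deriv ?_) (by simp [hA, hα])
    rw [hsymm i i t ht, hdiag, Matrix.mul_apply, Finset.sum_eq_single i, hsymm i i t ht]
    · intro j _ hj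
      rw [hoff i j t (Ne.symm hj) ht, zero_mul]
    · simp
  have hentry : ∀ i j, Tendsto (fun t => A t i j) atTop
      (𝓝 ((Real.sqrt w • (1 : Matrix (Fin 2) (Fin 2) ℝ)) i j)) := by
    intro i j
    by_cases hij : i = j
    · subst hij
      simpa using hdiagA i
    · have : (Real.sqrt w • (1 : Matrix (Fin 2) (Fin 2) ℝ)) i j = 0 := by simp [hij]
      rw [this]
      refine tendsto_const_nhds.congr' ?_
      filter_upwards [eventually_ge_atTop T] with t ht
      exact (hoff i j t hij ht).symm
  refine ⟨tendsto_pi_nhds.2 fun i => tendsto_pi_nhds.2 fun j => hentry i j,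
    tendsto_pi_nhds.2 fun i => tendsto_pi_nhds.2 fun j => ?_⟩
  have hT : (Real.sqrt w • (1 : Matrix (Fin 2) (Fin 2) ℝ)) i j
      = (Real.sqrt w • (1 : Matrix (Fin 2) (Fin 2) ℝ)) j i := by
    simp [Matrix.one_apply, eq_comm]
  rw [hT]
  refine (hentry j i).congr' ?_
  filter_upwards [eventually_ge_atTop T] with t ht
  exact (hsymm j i t ht).symm

/-! ### The symmetric post-training flow and its signs -/

/-- The post-training flow restricted to the invariant subspace of factor pairs
`A = !![a, b; c, d]`, `B = !![d, b; c, a]`, started from `√w • 1`. -/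
structure IsSymmetricFlow (w m T : ℝ) (a b c d : ℝ → ℝ) : Prop where
  deriv_a : ∀ t, T ≤ t → HasDerivWithinAt a
    (-((a t * d t + b t * c t - w) * d t + (2 * a t * b t - m) * b t)) (Set.Ici T) t
  deriv_b : ∀ t, T ≤ t → HasDerivWithinAt b
    (-((a t * d t + b t * c t - w) * c t + (2 * a t * b t - m) * a t)) (Set.Ici T) t
  deriv_c : ∀ t, T ≤ t → HasDerivWithinAt c
    (-((a t * d t + b t * c t - w) * b t)) (Set.Ici T) t
  deriv_d : ∀ t, T ≤ t → HasDerivWithinAt d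
    (-((a t * d t + b t * c t - w) * a t)) (Set.Ici T) t
  init_a : a T = Real.sqrt w
  init_b : b T = 0
  init_c : c T = 0
  init_d : d T = Real.sqrt w

namespace IsSymmetricFlow

variable {w m T S : ℝ} {a b c d : ℝ → ℝ}

section Derivatives

variable (H : IsSymmetricFlow w m T a b c d)
include H

theorem continuousOn_a : ContinuousOn a (Set.Ici T) :=
  fun t ht => (H.deriv_a t ht).continuousWithinAt

theorem continuousOn_b : ContinuousOn b (Set.Ici T) :=
  fun t ht => (H.deriv_b t ht).continuousWithinAt

theorem continuousOn_c : ContinuousOn c (Set.Ici T) :=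
  fun t ht => (H.deriv_c t ht).continuousWithinAt

theorem continuousOn_d : ContinuousOn d (Set.Ici T) :=
  fun t ht => (H.deriv_d t ht).continuousWithinAt

/-- This is a diagonal entry of the conserved matrix `AᵀA - BBᵀ`, which vanishes initially. -/
theorem balanced {t : ℝ} (ht : T ≤ t) : a t ^ 2 + c t ^ 2 = b t ^ 2 + d t ^ 2 := by
  have := eq_zero_of_hasDerivWithinAt (T := T) (g := fun _ => 0)
    (f := fun t => a t ^ 2 + c t ^ 2 - (b t ^ 2 + d t ^ 2)) continuousOn_const
    (fun s hs => ((((H.deriv_a s hs).fun_pow 2).fun_add ((H.deriv_c s hs).fun_pow 2)).fun_sub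
      (((H.deriv_b s hs).fun_pow 2).fun_add ((H.deriv_d s hs).fun_pow 2))).congr_deriv
      (by norm_num; ring))
    (by simp [H.init_a, H.init_b, H.init_c, H.init_d]) ht
  linarith

theorem deriv_offDiag {t : ℝ} (ht : T ≤ t) :
    HasDerivWithinAt (fun t => 2 * a t * b t - m)
      (-2 * (a t ^ 2 + b t ^ 2) * (2 * a t * b t - m)
        - 2 * (a t * d t + b t * c t - w) * (b t * d t + a t * c t)) (Set.Ici T) t :=
  ((((H.deriv_a t ht).const_mul 2).fun_mul (H.deriv_b t ht)).sub_const m).congr_deriv (by ring)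

theorem deriv_diag {t : ℝ} (ht : T ≤ t) :
    HasDerivWithinAt (fun t => a t * d t + b t * c t - w)
      (-(a t ^ 2 + b t ^ 2 + c t ^ 2 + d t ^ 2) * (a t * d t + b t * c t - w)
        - (2 * a t * b t - m) * (b t * d t + a t * c t)) (Set.Ici T) t :=
  ((((H.deriv_a t ht).fun_mul (H.deriv_d t ht)).fun_add
    ((H.deriv_b t ht).fun_mul (H.deriv_c t ht))).sub_const w).congr_deriv (by ring)

theorem deriv_unobserved {t : ℝ} (ht : T ≤ t) :
    HasDerivWithinAt (fun t => 2 * c t * d t)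
      (-2 * (a t * d t + b t * c t - w) * (b t * d t + a t * c t)) (Set.Ici T) t :=
  (((H.deriv_c t ht).const_mul 2).fun_mul (H.deriv_d t ht)).congr_deriv (by ring)

theorem deriv_a_add_d {t : ℝ} (ht : T ≤ t) :
    HasDerivWithinAt (fun t => a t + d t)
      (-(a t * d t + b t * c t - w) * (a t + d t) - (2 * a t * b t - m) * b t) (Set.Ici T) t :=
  ((H.deriv_a t ht).fun_add (H.deriv_d t ht)).congr_deriv (by ring)

theorem deriv_b_sub_c {t : ℝ} (ht : T ≤ t) :
    HasDerivWithinAt (fun t => b t - c t)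
      ((a t * d t + b t * c t - w) * (b t - c t) - (2 * a t * b t - m) * a t) (Set.Ici T) t :=
  ((H.deriv_b t ht).fun_sub (H.deriv_c t ht)).congr_deriv (by ring)

theorem deriv_b_add_c {t : ℝ} (ht : T ≤ t) :
    HasDerivWithinAt (fun t => b t + c t)
      (-(a t * d t + b t * c t - w) * (b t + c t) - (2 * a t * b t - m) * a t) (Set.Ici T) t :=
  ((H.deriv_b t ht).fun_add (H.deriv_c t ht)).congr_deriv (by ring)

/-- Balancedness factors as `(a - d) (a + d) = (b - c) (b + c)`. Substituting for `a` turns the term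
`-σ a` in the equations of `b ∓ c` into a multiple of the unknown plus the forcing `-σ (a + d) / 2`,
positive in the region. -/
theorem two_mul_a {t : ℝ} (ht : T ≤ t) :
    2 * (a t + d t) * a t = (a t + d t) ^ 2 + (b t - c t) * (b t + c t) := by
  linear_combination H.balanced ht

end Derivatives

/-- The open region in which the sign analysis of the flow takes place. -/
def InRegion (m : ℝ) (a b c d : ℝ → ℝ) (t : ℝ) : Prop :=
  2 * a t * b t - m < 0 ∧ 0 < a t * d t + b t * c t ∧ 0 < a t + d t

section Region

variable (H : IsSymmetricFlow w m T a b c d)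
include H

theorem b_sub_c_nonneg (hR : ∀ t ∈ Set.Ico T S, InRegion m a b c d t) {t : ℝ}
    (ht : t ∈ Set.Ico T S) : 0 ≤ b t - c t := by
  have hsub : Set.Icc T t ⊆ Set.Ico T S := fun s hs => ⟨hs.1, hs.2.trans_lt ht.2⟩
  have ca : ContinuousOn a (Set.Icc T t) := H.continuousOn_a.mono Set.Icc_subset_Ici_self
  have cb : ContinuousOn b (Set.Icc T t) := H.continuousOn_b.mono Set.Icc_subset_Ici_self
  have cc : ContinuousOn c (Set.Icc T t) := H.continuousOn_c.mono Set.Icc_subset_Ici_self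
  have cd : ContinuousOn d (Set.Icc T t) := H.continuousOn_d.mono Set.Icc_subset_Ici_self
  have hx : ∀ s ∈ Set.Icc T t, 2 * (a s + d s) ≠ 0 := fun s hs =>
    mul_ne_zero two_ne_zero (hR s (hsub hs)).2.2.ne'
  refine nonneg_of_hasDerivWithinAt (T := T) (f := fun t => b t - c t)
    (g := fun t => (a t * d t + b t * c t - w)
      - (2 * a t * b t - m) * (b t + c t) / (2 * (a t + d t)))
    (h := fun t => -(2 * a t * b t - m) * (a t + d t) / 2) ht.1 ?_ (fun s hs => ?_)
    (fun s hs => ?_) (by simp [H.init_b, H.init_c])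
  · exact ContinuousOn.sub (by fun_prop) (ContinuousOn.div (by fun_prop) (by fun_prop) hx)
  · refine (H.deriv_b_sub_c hs.1).congr_deriv ?_
    have h1 := (hR s (hsub hs)).2.2.ne'
    field_simp
    linear_combination (-(2 * a s * b s - m)) * H.two_mul_a hs.1
  · have h1 := hR s (hsub (Set.Ioo_subset_Icc_self hs))
    have := mul_pos (neg_pos.2 h1.1) h1.2.2
    linarith

theorem b_add_c_nonneg (hR : ∀ t ∈ Set.Ico T S, InRegion m a b c d t) {t : ℝ}
    (ht : t ∈ Set.Ico T S) : 0 ≤ b t + c t ∧ (T < t → 0 < b t + c t) := by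
  have hsub : Set.Icc T t ⊆ Set.Ico T S := fun s hs => ⟨hs.1, hs.2.trans_lt ht.2⟩
  have ca : ContinuousOn a (Set.Icc T t) := H.continuousOn_a.mono Set.Icc_subset_Ici_self
  have cb : ContinuousOn b (Set.Icc T t) := H.continuousOn_b.mono Set.Icc_subset_Ici_self
  have cc : ContinuousOn c (Set.Icc T t) := H.continuousOn_c.mono Set.Icc_subset_Ici_self
  have cd : ContinuousOn d (Set.Icc T t) := H.continuousOn_d.mono Set.Icc_subset_Ici_self
  have hx : ∀ s ∈ Set.Icc T t, 2 * (a s + d s) ≠ 0 := fun s hs =>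
    mul_ne_zero two_ne_zero (hR s (hsub hs)).2.2.ne'
  have hg : ContinuousOn (fun t => -(a t * d t + b t * c t - w)
      - (2 * a t * b t - m) * (b t - c t) / (2 * (a t + d t))) (Set.Icc T t) :=
    ContinuousOn.sub (by fun_prop) (ContinuousOn.div (by fun_prop) (by fun_prop) hx)
  have hd : ∀ s ∈ Set.Icc T t, HasDerivWithinAt (fun t => b t + c t)
      ((-(a s * d s + b s * c s - w)
        - (2 * a s * b s - m) * (b s - c s) / (2 * (a s + d s))) * (b s + c s)
        + -(2 * a s * b s - m) * (a s + d s) / 2) (Set.Ici T) s := by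
    intro s hs
    refine (H.deriv_b_add_c hs.1).congr_deriv ?_
    have h1 := (hR s (hsub hs)).2.2.ne'
    field_simp
    linear_combination (-(2 * a s * b s - m)) * H.two_mul_a hs.1
  have hpos : ∀ s ∈ Set.Ioo T t, 0 < -(2 * a s * b s - m) * (a s + d s) / 2 := by
    intro s hs
    have h1 := hR s (hsub (Set.Ioo_subset_Icc_self hs))
    have := mul_pos (neg_pos.2 h1.1) h1.2.2
    linarith
  have h0 : 0 ≤ b T + c T := by simp [H.init_b, H.init_c]
  exact ⟨nonneg_of_hasDerivWithinAt (f := fun t => b t + c t)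
      (h := fun s => -(2 * a s * b s - m) * (a s + d s) / 2) ht.1 hg hd
      (fun s hs => (hpos s hs).le) h0,
    fun hlt => pos_of_hasDerivWithinAt_of_forcing_pos (f := fun t => b t + c t)
      (h := fun s => -(2 * a s * b s - m) * (a s + d s) / 2) hlt hg hd hpos h0⟩

/-- With `x = a + d` and `v = b + c`, the coupling is `2 x v / (x² + v²)` times the diagonal entry.
This yields both its sign and the bound `coupling_le`. -/
theorem coupling_mul {t : ℝ} (ht : T ≤ t) :
    (b t * d t + a t * c t) * ((a t + d t) ^ 2 + (b t + c t) ^ 2)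
      = 2 * (b t + c t) * (a t + d t) * (a t * d t + b t * c t) := by
  linear_combination (a t * c t - b t * d t) * H.balanced ht

theorem coupling_nonneg (hR : ∀ t ∈ Set.Ico T S, InRegion m a b c d t) {t : ℝ}
    (ht : t ∈ Set.Ico T S) :
    0 ≤ b t * d t + a t * c t ∧ (T < t → 0 < b t * d t + a t * c t) := by
  obtain ⟨-, hrw, hx⟩ := hR t ht
  obtain ⟨hv, hv'⟩ := H.b_add_c_nonneg hR ht
  have hden : 0 < (a t + d t) ^ 2 + (b t + c t) ^ 2 := by positivity
  have heq := H.coupling_mul ht.1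
  refine ⟨?_, fun hlt => ?_⟩
  · refine nonneg_of_mul_nonneg_left ?_ hden
    rw [heq]
    positivity
  · have := hv' hlt
    refine pos_of_mul_pos_left ?_ hden.le
    rw [heq]
    positivity

theorem diag_residual_nonneg (hw : 0 < w) (hR : ∀ t ∈ Set.Ico T S, InRegion m a b c d t) {t : ℝ}
    (ht : t ∈ Set.Icc T S) :
    0 ≤ a t * d t + b t * c t - w ∧ (T < t → 0 < a t * d t + b t * c t - w) := by
  have ca : ContinuousOn a (Set.Icc T t) := H.continuousOn_a.mono Set.Icc_subset_Ici_self
  have cb : ContinuousOn b (Set.Icc T t) := H.continuousOn_b.mono Set.Icc_subset_Ici_self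
  have cc : ContinuousOn c (Set.Icc T t) := H.continuousOn_c.mono Set.Icc_subset_Ici_self
  have cd : ContinuousOn d (Set.Icc T t) := H.continuousOn_d.mono Set.Icc_subset_Ici_self
  have hg : ContinuousOn (fun t => -(a t ^ 2 + b t ^ 2 + c t ^ 2 + d t ^ 2)) (Set.Icc T t) := by
    fun_prop
  have hd : ∀ s ∈ Set.Icc T t, HasDerivWithinAt (fun t => a t * d t + b t * c t - w)
      (-(a s ^ 2 + b s ^ 2 + c s ^ 2 + d s ^ 2) * (a s * d s + b s * c s - w)
        + -(2 * a s * b s - m) * (b s * d s + a s * c s)) (Set.Ici T) s := fun s hs =>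
    (H.deriv_diag hs.1).congr_deriv (by ring)
  have hpos : ∀ s ∈ Set.Ioo T t, 0 < -(2 * a s * b s - m) * (b s * d s + a s * c s) := by
    intro s hs
    have hs' : s ∈ Set.Ico T S := ⟨hs.1.le, hs.2.trans_le ht.2⟩
    exact mul_pos (neg_pos.2 (hR s hs').1) ((H.coupling_nonneg hR hs').2 hs.1)
  have h0 : 0 ≤ a T * d T + b T * c T - w := by
    simp [H.init_a, H.init_b, H.init_d, Real.mul_self_sqrt hw.le]
  exact ⟨nonneg_of_hasDerivWithinAt (f := fun t => a t * d t + b t * c t - w)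
      (h := fun s => -(2 * a s * b s - m) * (b s * d s + a s * c s)) ht.1 hg hd
      (fun s hs => (hpos s hs).le) h0,
    fun hlt => pos_of_hasDerivWithinAt_of_forcing_pos (f := fun t => a t * d t + b t * c t - w)
      (h := fun s => -(2 * a s * b s - m) * (b s * d s + a s * c s)) hlt hg hd hpos h0⟩

/-- The region cannot be left: inside it `-σ` and `a + d` solve linear equations with nonnegative
forcing from positive initial values, and `r ≥ 0` keeps the diagonal entry at least `w`. -/
theorem inRegion_of_forall_Ico (hw : 0 < w) (hm : 0 < m) (hTS : T ≤ S)
    (hR : ∀ t ∈ Set.Ico T S, InRegion m a b c d t) : InRegion m a b c d S := by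
  have ca : ContinuousOn a (Set.Icc T S) := H.continuousOn_a.mono Set.Icc_subset_Ici_self
  have cb : ContinuousOn b (Set.Icc T S) := H.continuousOn_b.mono Set.Icc_subset_Ici_self
  have cc : ContinuousOn c (Set.Icc T S) := H.continuousOn_c.mono Set.Icc_subset_Ici_self
  have cd : ContinuousOn d (Set.Icc T S) := H.continuousOn_d.mono Set.Icc_subset_Ici_self
  refine ⟨?_, ?_, ?_⟩
  · have : 0 < -(2 * a S * b S - m) := by
      refine pos_of_hasDerivWithinAt (f := fun t => -(2 * a t * b t - m))
        (g := fun t => -2 * (a t ^ 2 + b t ^ 2))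
        (h := fun t => 2 * (a t * d t + b t * c t - w) * (b t * d t + a t * c t)) hTS
        (by fun_prop) (fun s hs => (H.deriv_offDiag hs.1).fun_neg.congr_deriv (by ring))
        (fun s hs => ?_) (by simp [H.init_b, hm])
      exact mul_nonneg (mul_nonneg zero_le_two
        (H.diag_residual_nonneg hw hR (Set.Ioo_subset_Icc_self hs)).1)
        (H.coupling_nonneg hR (Set.Ioo_subset_Ico_self hs)).1
    linarith
  · linarith [(H.diag_residual_nonneg hw hR (Set.right_mem_Icc.2 hTS)).1]
  · refine pos_of_hasDerivWithinAt (f := fun t => a t + d t)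
      (g := fun t => -(a t * d t + b t * c t - w)) (h := fun t => -(2 * a t * b t - m) * b t) hTS
      (by fun_prop) (fun s hs => (H.deriv_a_add_d hs.1).congr_deriv (by ring))
      (fun s hs => ?_) (by
        have := Real.sqrt_pos.2 hw
        simp only [H.init_a, H.init_d]
        linarith)
    have hs' := Set.Ioo_subset_Ico_self hs
    have h1 := H.b_sub_c_nonneg hR hs'
    have h2 := (H.b_add_c_nonneg hR hs').1
    exact mul_nonneg (neg_pos.2 (hR s hs').1).le (by linarith)

theorem inRegion (hw : 0 < w) (hm : 0 < m) {t : ℝ} (ht : T ≤ t) : InRegion m a b c d t := by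
  have key : ∀ t, InRegion m a b c d t ↔
      0 < min (-(2 * a t * b t - m)) (min (a t * d t + b t * c t) (a t + d t)) := by
    intro t
    simp only [InRegion, lt_min_iff, neg_pos]
  have ca := H.continuousOn_a
  have cb := H.continuousOn_b
  have cc := H.continuousOn_c
  have cd := H.continuousOn_d
  rw [key]
  -- The minimum encodes the three strict inequalities as positivity of one continuous function.
  refine pos_of_forall_Ico_pos (T := T)
    (f := fun t => min (-(2 * a t * b t - m)) (min (a t * d t + b t * c t) (a t + d t)))
    (by fun_prop) (fun S hS hlt => ?_) ht
  exact (key S).1 (H.inRegion_of_forall_Ico hw hm hS fun s hs => (key s).2 (hlt s hs))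

end Region

section Global

variable (H : IsSymmetricFlow w m T a b c d) (hw : 0 < w) (hm : 0 < m) {t : ℝ}
include H hw hm

theorem signs (ht : T ≤ t) : 2 * a t * b t - m < 0 ∧ 0 < a t + d t ∧ 0 ≤ b t - c t ∧
    0 ≤ b t + c t ∧ 0 ≤ b t * d t + a t * c t ∧ 0 ≤ a t * d t + b t * c t - w := by
  have hR : ∀ s ∈ Set.Ico T (t + 1), InRegion m a b c d s := fun s hs => H.inRegion hw hm hs.1
  have ht' : t ∈ Set.Ico T (t + 1) := ⟨ht, by linarith⟩
  exact ⟨(hR t ht').1, (hR t ht').2.2, H.b_sub_c_nonneg hR ht', (H.b_add_c_nonneg hR ht').1,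
    (H.coupling_nonneg hR ht').1, (H.diag_residual_nonneg hw hR (Set.Ico_subset_Icc_self ht')).1⟩

theorem unobserved_neg (ht : T < t) : 2 * c t * d t < 0 := by
  have : 0 < -(2 * c t * d t) := by
    refine pos_of_hasDerivWithinAt_of_forcing_pos (f := fun t => -(2 * c t * d t))
      (g := fun _ => 0)
      (h := fun t => 2 * (a t * d t + b t * c t - w) * (b t * d t + a t * c t)) ht
      continuousOn_const
      (fun s hs => (H.deriv_unobserved hs.1).fun_neg.congr_deriv (by ring)) (fun s hs => ?_)
      (by simp [H.init_c])
    have hR : ∀ s' ∈ Set.Ico T t, InRegion m a b c d s' := fun s' hs' => H.inRegion hw hm hs'.1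
    exact mul_pos (mul_pos two_pos
      ((H.diag_residual_nonneg hw hR (Set.Ioo_subset_Icc_self hs)).2 hs.1))
      ((H.coupling_nonneg hR (Set.Ioo_subset_Ico_self hs)).2 hs.1)
  linarith

theorem c_nonpos (ht : T ≤ t) : c t ≤ 0 := by
  have : 0 ≤ -c t := by
    refine nonneg_of_hasDerivWithinAt (f := fun t => -c t) (g := fun _ => 0)
      (h := fun t => (a t * d t + b t * c t - w) * b t) ht continuousOn_const
      (fun s hs => (H.deriv_c s hs.1).fun_neg.congr_deriv (by ring)) (fun s hs => ?_)
      (by simp [H.init_c])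
    obtain ⟨-, -, h1, h2, -, h3⟩ := H.signs hw hm hs.1.le
    exact mul_nonneg h3 (by linarith)
  linarith

/-- The left side is twice the loss. Since `a² ≥ a d ≥ w` (from `u v ≥ 0`, `b c ≤ 0`, `r ≥ 0`), the
dissipation exceeds what rate `2 w` requires by at least `4 (r d + σ b)²`. -/
theorem residual_sq_le (ht : T ≤ t) :
    2 * (a t * d t + b t * c t - w) ^ 2 + (2 * a t * b t - m) ^ 2
      ≤ m ^ 2 * Real.exp (-2 * w * (t - T)) := by
  have hE : ∀ s, HasDerivWithinAt (fun t => Real.exp (-2 * w * (t - T)))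
      (Real.exp (-2 * w * (s - T)) * (-2 * w * 1)) (Set.Ici T) s := fun s =>
    ((((hasDerivAt_id s).sub_const T).const_mul (-2 * w)).exp).hasDerivWithinAt
  refine sub_nonneg.1 (nonneg_of_hasDerivWithinAt
    (f := fun t => m ^ 2 * Real.exp (-2 * w * (t - T))
      - (2 * (a t * d t + b t * c t - w) ^ 2 + (2 * a t * b t - m) ^ 2))
    (g := fun _ => -2 * w)
    (h := fun t => 4 * ((a t * d t + b t * c t - w) ^ 2
        * (a t ^ 2 + b t ^ 2 + c t ^ 2 + d t ^ 2 - w)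
      + (2 * a t * b t - m) ^ 2 * (a t ^ 2 + b t ^ 2 - w / 2)
      + 2 * (a t * d t + b t * c t - w) * (2 * a t * b t - m) * (b t * d t + a t * c t)))
    ht continuousOn_const (fun s hs => ?_) (fun s hs => ?_) ?_)
  · refine (((hE s).const_mul (m ^ 2)).fun_sub
      ((((H.deriv_diag hs.1).fun_pow 2).const_mul 2).fun_add
        ((H.deriv_offDiag hs.1).fun_pow 2))).congr_deriv ?_
    norm_num
    ring
  · obtain ⟨hs0, hx, hu, hv, hq, hr⟩ := H.signs hw hm hs.1.le
    have hc := H.c_nonpos hw hm hs.1.le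
    have h2 := H.two_mul_a hs.1.le
    have hbal := H.balanced hs.1.le
    set r := a s * d s + b s * c s - w with hrdef
    set σ := 2 * a s * b s - m with hσ
    have ha : 0 < a s := by
      have : 0 < 2 * (a s + d s) * a s := by rw [h2]; positivity
      exact pos_of_mul_pos_right this (by linarith)
    have hb : 0 ≤ b s := by linarith
    have hbc : b s * c s ≤ 0 := mul_nonpos_of_nonneg_of_nonpos hb hc
    have huv := mul_nonneg hu hv
    have hasq : w ≤ a s ^ 2 := by
      have := sq_nonneg (a s - d s)
      linarith [hrdef]
    have hac : a s * c s ≤ 0 := mul_nonpos_of_nonneg_of_nonpos ha.le hc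
    -- As `r σ ≤ 0` and `a c ≤ 0`, dropping `a c` from the coupling only lowers the cross term, and
    -- a perfect square remains.
    have h3 : r * σ * (b s * d s) ≤ r * σ * (b s * d s + a s * c s) :=
      mul_le_mul_of_nonpos_left (by linarith) (mul_nonpos_of_nonneg_of_nonpos hr hs0.le)
    have h4 : r ^ 2 * d s ^ 2 ≤ r ^ 2 * (a s ^ 2 + b s ^ 2 + c s ^ 2 + d s ^ 2 - w) :=
      mul_le_mul_of_nonneg_left (by linarith [sq_nonneg (b s), sq_nonneg (c s)]) (sq_nonneg _)
    have h5 : σ ^ 2 * b s ^ 2 ≤ σ ^ 2 * (a s ^ 2 + b s ^ 2 - w / 2) :=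
      mul_le_mul_of_nonneg_left (by linarith) (sq_nonneg _)
    linarith [sq_nonneg (r * d s + σ * b s)]
  · simp [H.init_a, H.init_b, H.init_d, Real.mul_self_sqrt hw.le]

end Global

end IsSymmetricFlow

/-! ### Convergence and the singular value ratio -/

theorem sq_mul_exp (m w τ : ℝ) :
    (m * Real.exp (-w * τ)) ^ 2 = m ^ 2 * Real.exp (-2 * w * τ) := by
  rw [mul_pow, ← Real.exp_nat_mul]
  congr 2
  push_cast
  ring

theorem hasDerivWithinAt_exp_mul_sub (k T s : ℝ) (I : Set ℝ) :
    HasDerivWithinAt (fun t => Real.exp (k * (t - T))) (Real.exp (k * (s - T)) * k) I s :=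
  ((((hasDerivAt_id s).sub_const T).const_mul k).exp).hasDerivWithinAt.congr_deriv (by simp)

namespace IsSymmetricFlow

variable {w m T t : ℝ} {a b c d : ℝ → ℝ}
variable (H : IsSymmetricFlow w m T a b c d) (hw : 0 < w) (hm : 0 < m)
include H hw hm

theorem neg_offDiag_le (ht : T ≤ t) : -(2 * a t * b t - m) ≤ m * Real.exp (-w * (t - T)) := by
  refine abs_le_of_sq_le_sq' ?_ (by positivity) |>.2
  rw [sq_mul_exp]
  have := H.residual_sq_le hw hm ht
  nlinarith [sq_nonneg (a t * d t + b t * c t - w)]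

theorem diag_le (ht : T ≤ t) : a t * d t + b t * c t - w ≤ m * Real.exp (-w * (t - T)) := by
  refine abs_le_of_sq_le_sq' ?_ (by positivity) |>.2
  rw [sq_mul_exp]
  have := H.residual_sq_le hw hm ht
  nlinarith [sq_nonneg (a t * d t + b t * c t - w), sq_nonneg (2 * a t * b t - m)]

theorem coupling_le (ht : T ≤ t) : b t * d t + a t * c t ≤ a t * d t + b t * c t := by
  obtain ⟨-, hrw, hx⟩ := H.inRegion hw hm ht
  have hden : 0 < (a t + d t) ^ 2 + (b t + c t) ^ 2 := by positivity
  refine le_of_mul_le_mul_right ?_ hden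
  rw [H.coupling_mul ht]
  nlinarith [mul_nonneg hrw.le (sq_nonneg ((a t + d t) - (b t + c t)))]

/-- The speed `2 r q` is at most `2 (m + w) m exp(-w (t - T))`, because `q ≤ r + w ≤ m + w`; the
bound is the integral of this over all time. -/
theorem unobserved_ge (ht : T ≤ t) : -(2 * (m + w) * m / w) ≤ 2 * c t * d t := by
  have : 0 ≤ 2 * c t * d t - 2 * (m + w) * m / w * Real.exp (-w * (t - T))
      + 2 * (m + w) * m / w := by
    refine nonneg_of_hasDerivWithinAt (f := fun t => 2 * c t * d t
        - 2 * (m + w) * m / w * Real.exp (-w * (t - T)) + 2 * (m + w) * m / w)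
      (g := fun _ => 0)
      (h := fun t => 2 * ((m + w) * (m * Real.exp (-w * (t - T)))
        - (a t * d t + b t * c t - w) * (b t * d t + a t * c t))) ht
      continuousOn_const (fun s hs => ?_) (fun s hs => ?_) (by simp [H.init_c])
    · refine (((H.deriv_unobserved hs.1).fun_sub
        ((hasDerivWithinAt_exp_mul_sub (-w) T s _).const_mul _)).add_const _).congr_deriv ?_
      field_simp
      ring
    · obtain ⟨-, -, -, -, hq, hr⟩ := H.signs hw hm hs.1.le
      have h1 := H.diag_le hw hm hs.1.le
      have h2 := H.coupling_le hw hm hs.1.le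
      have h3 : Real.exp (-w * (s - T)) ≤ 1 := Real.exp_le_one_iff.2 (by nlinarith [hs.1])
      have h4 : m * Real.exp (-w * (s - T)) ≤ m * 1 := by gcongr
      have h5 : b s * d s + a s * c s ≤ m + w := by linarith
      have := mul_le_mul h1 h5 hq (by positivity)
      linarith
  have hE : 0 ≤ 2 * (m + w) * m / w * Real.exp (-w * (t - T)) := by positivity
  linarith

theorem unobserved_antitone {s : ℝ} (hs : T ≤ s) (hst : s ≤ t) :
    2 * c t * d t ≤ 2 * c s * d s := by
  have := nonneg_of_hasDerivWithinAt (T := s) (S := t)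
    (f := fun t => 2 * c s * d s - 2 * c t * d t) (g := fun _ => 0)
    (h := fun t => 2 * (a t * d t + b t * c t - w) * (b t * d t + a t * c t)) hst
    continuousOn_const
    (fun r hr => (((H.deriv_unobserved (hs.trans hr.1)).mono
      (Set.Ici_subset_Ici.2 hs)).const_sub _).congr_deriv (by ring))
    (fun r hr => by
      obtain ⟨-, -, -, -, hq, hr⟩ := H.signs hw hm (hs.trans hr.1.le)
      exact mul_nonneg (mul_nonneg zero_le_two hr) hq) (by simp)
  linarith

theorem exists_tendsto_unobserved : ∃ l, Tendsto (fun t => 2 * c t * d t) atTop (𝓝 l) := by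
  -- Freezing time at `T` extends the monotonicity to the whole line without affecting the limit.
  have hanti : Antitone fun t => 2 * c (max t T) * d (max t T) := fun s t hst =>
    H.unobserved_antitone hw hm (le_max_right _ _) (max_le_max_right T hst)
  have hbdd : BddBelow (Set.range fun t => 2 * c (max t T) * d (max t T)) := by
    refine ⟨-(2 * (m + w) * m / w), ?_⟩
    rintro _ ⟨t, rfl⟩
    exact H.unobserved_ge hw hm (le_max_right _ _)
  refine ⟨_, (tendsto_atTop_ciInf hanti hbdd).congr' ?_⟩
  filter_upwards [eventually_ge_atTop T] with t ht
  rw [max_eq_left ht]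

theorem tendsto_residual :
    Tendsto (fun t => a t * d t + b t * c t - w) atTop (𝓝 0) ∧
    Tendsto (fun t => -(2 * a t * b t - m)) atTop (𝓝 0) := by
  have hlim : Tendsto (fun t => m * Real.exp (-w * (t - T))) atTop (𝓝 0) := by
    rw [← mul_zero m]
    refine Tendsto.const_mul m (Real.tendsto_exp_atBot.comp ?_)
    exact (tendsto_atTop_add_const_right _ (-T) tendsto_id).const_mul_atTop_of_neg (by linarith)
  constructor
  · refine tendsto_of_tendsto_of_tendsto_of_le_of_le' tendsto_const_nhds hlim ?_ ?_
    · filter_upwards [eventually_ge_atTop T] with t ht using (H.signs hw hm ht).2.2.2.2.2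
    · filter_upwards [eventually_ge_atTop T] with t ht using H.diag_le hw hm ht
  · refine tendsto_of_tendsto_of_tendsto_of_le_of_le' tendsto_const_nhds hlim ?_ ?_
    · filter_upwards [eventually_ge_atTop T] with t ht using (neg_pos.2 (H.signs hw hm ht).1).le
    · filter_upwards [eventually_ge_atTop T] with t ht using H.neg_offDiag_le hw hm ht

/-- The ratio of the singular values of the factors, `(x + v) / (x - v)` for `x = a + d` and
`v = b + c`, is bounded along the flow. -/
theorem singular_ratio_le (ht : T ≤ t) : 0 < a t + d t - (b t + c t) ∧
    a t + d t + (b t + c t) ≤ Real.exp (m / w) * (a t + d t - (b t + c t)) := by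
  have ca : ContinuousOn a (Set.Ici T) := H.continuousOn_a
  have cb : ContinuousOn b (Set.Ici T) := H.continuousOn_b
  have cc : ContinuousOn c (Set.Ici T) := H.continuousOn_c
  have cd : ContinuousOn d (Set.Ici T) := H.continuousOn_d
  have hx : ∀ s, T ≤ s → 0 < a s + d s := fun s hs => (H.signs hw hm hs).2.1
  have hx2 : ∀ s ∈ Set.Ici T, 2 * (a s + d s) ≠ 0 := fun s hs =>
    mul_ne_zero two_ne_zero (hx s hs).ne'
  -- `κ` is the common part of the growth rates of `x ± v`, which are `κ ∓ σ / 2`; it cancels in the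
  -- ratio.
  set κ : ℝ → ℝ := fun t => -(a t * d t + b t * c t - w)
    - (2 * a t * b t - m) * (b t - c t) / (2 * (a t + d t)) with hκ
  have hκc : ContinuousOn κ (Set.Ici T) :=
    ContinuousOn.sub (by fun_prop) (ContinuousOn.div (by fun_prop) (by fun_prop) hx2)
  have hsub : ∀ s, T ≤ s → HasDerivWithinAt (fun t => a t + d t - (b t + c t))
      ((κ s + (2 * a s * b s - m) / 2) * (a s + d s - (b s + c s))) (Set.Ici T) s := by
    intro s hs
    refine ((H.deriv_a_add_d hs).fun_sub (H.deriv_b_add_c hs)).congr_deriv ?_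
    have h1 := (hx s hs).ne'
    simp only [hκ]
    field_simp
    linear_combination (2 * a s * b s - m) * H.balanced hs
  have hadd : ∀ s, T ≤ s → HasDerivWithinAt (fun t => a t + d t + (b t + c t))
      ((κ s - (2 * a s * b s - m) / 2) * (a s + d s + (b s + c s))) (Set.Ici T) s := by
    intro s hs
    refine ((H.deriv_a_add_d hs).fun_add (H.deriv_b_add_c hs)).congr_deriv ?_
    have h1 := (hx s hs).ne'
    simp only [hκ]
    field_simp
    linear_combination (-(2 * a s * b s - m)) * H.balanced hs
  have hpos : ∀ s, T ≤ s → 0 < a s + d s - (b s + c s) := fun s hs =>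
    pos_of_hasDerivWithinAt (f := fun t => a t + d t - (b t + c t))
      (g := fun s => κ s + (2 * a s * b s - m) / 2) (h := fun _ => 0) hs
      (ContinuousOn.mono (by fun_prop) Set.Icc_subset_Ici_self)
      (fun r hr => (hsub r hr.1).congr_deriv (by ring)) (fun _ _ => le_rfl)
      (by simpa [H.init_a, H.init_b, H.init_c, H.init_d] using hw)
  refine ⟨hpos t ht, ?_⟩
  -- The exponent is the integral from `T` of the bound `m exp(-w (t - T))` on `-σ`.
  have hE : ∀ s, HasDerivWithinAt (fun t => Real.exp (m / w * (1 - Real.exp (-w * (t - T)))))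
      (Real.exp (m / w * (1 - Real.exp (-w * (s - T)))) * (m * Real.exp (-w * (s - T))))
      (Set.Ici T) s := by
    intro s
    refine ((((hasDerivWithinAt_exp_mul_sub (-w) T s (Set.Ici T)).const_sub 1).const_mul
      (m / w)).exp).congr_deriv ?_
    field_simp
  have h1 : a t + d t + (b t + c t) ≤ Real.exp (m / w * (1 - Real.exp (-w * (t - T))))
      * (a t + d t - (b t + c t)) := by
    refine sub_nonneg.1 (nonneg_of_hasDerivWithinAt
      (f := fun t => Real.exp (m / w * (1 - Real.exp (-w * (t - T))))
        * (a t + d t - (b t + c t)) - (a t + d t + (b t + c t)))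
      (g := fun s => κ s - (2 * a s * b s - m) / 2)
      (h := fun s => Real.exp (m / w * (1 - Real.exp (-w * (s - T))))
        * (a s + d s - (b s + c s)) * (m * Real.exp (-w * (s - T)) + (2 * a s * b s - m))) ht
      (ContinuousOn.mono (by fun_prop) Set.Icc_subset_Ici_self)
      (fun s hs => (((hE s).fun_mul (hsub s hs.1)).fun_sub (hadd s hs.1)).congr_deriv (by ring))
      (fun s hs => ?_) (by simp [H.init_a, H.init_b, H.init_c, H.init_d]))
    have h2 := hpos s hs.1.le
    have h3 := H.neg_offDiag_le hw hm hs.1.le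
    exact mul_nonneg (by positivity) (by linarith)
  refine h1.trans (mul_le_mul_of_nonneg_right (Real.exp_le_exp.2 ?_) (hpos t ht).le)
  have hexp := Real.exp_pos (-w * (t - T))
  have hmw : 0 < m / w := by positivity
  nlinarith

/-- For `k = (x + v) / (x - v)`, the quotient of `2 a b + 2 c d` by `det A` is exactly `k - k⁻¹`,
which increases with `k ≤ N`. Squaring leaves only entries of the product: the first factor on the
right is its determinant, so the bound passes to the limit. -/
theorem antidiag_sum_le (ht : T ≤ t) :
    (2 * a t * b t + 2 * c t * d t) ^ 2
      ≤ (a t * d t - b t * c t) ^ 2 * (Real.exp (m / w) - (Real.exp (m / w))⁻¹) ^ 2 := by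
  obtain ⟨hn, hle⟩ := H.singular_ratio_le hw hm ht
  obtain ⟨-, hx, hu, hv, -, -⟩ := H.signs hw hm ht
  have hbal := H.balanced ht
  set N := Real.exp (m / w) with hN
  have hN0 : 0 < N := Real.exp_pos _
  set x := a t + d t with hxdef
  set u := b t - c t with hudef
  set v := b t + c t with hvdef
  have hsum : (2 * a t * b t + 2 * c t * d t) * x ^ 2 = v * x * (x ^ 2 + u ^ 2) := by
    rw [hxdef, hudef, hvdef]
    linear_combination (b t - c t) * (a t + d t) * hbal
  have hdet : (a t * d t - b t * c t) * (4 * x ^ 2) = (x ^ 2 + u ^ 2) * (x ^ 2 - v ^ 2) := by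
    rw [hxdef, hudef, hvdef]
    linear_combination (c t ^ 2 + d t ^ 2 - a t ^ 2 - b t ^ 2) * hbal
  have hkey : 4 * (v * x) ≤ (x ^ 2 - v ^ 2) * (N - N⁻¹) := by
    -- This is `(N - k) (k + N⁻¹) ≥ 0`, cleared of the denominators of `k`.
    have : 0 ≤ (N * (x - v) - (x + v)) * ((x + v) + (x - v) * N⁻¹) :=
      mul_nonneg (by linarith) (by positivity)
    have hNN : N * N⁻¹ = 1 := mul_inv_cancel₀ hN0.ne'
    linear_combination this + (x - v) ^ 2 * hNN
  have hx2 : 0 < 4 * x ^ 2 := by positivity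
  have hle2 : 2 * a t * b t + 2 * c t * d t ≤ (a t * d t - b t * c t) * (N - N⁻¹) := by
    refine le_of_mul_le_mul_right ?_ hx2
    have h1 := mul_le_mul_of_nonneg_left hkey (by positivity : 0 ≤ x ^ 2 + u ^ 2)
    linear_combination h1 + 4 * hsum - (N - N⁻¹) * hdet
  have h0 : 0 ≤ 2 * a t * b t + 2 * c t * d t := by
    refine nonneg_of_mul_nonneg_left (b := x ^ 2) ?_ (by positivity)
    rw [hsum]
    positivity
  rw [← mul_pow]
  exact pow_le_pow_left₀ h0 hle2 2

end IsSymmetricFlow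

/-! ### Stable rank of a 2 × 2 matrix -/

theorem quadratic_form_nonneg {α β γ x y : ℝ} (htr : 0 < α + γ) (hdet : β ^ 2 ≤ α * γ) :
    0 ≤ α * x ^ 2 + 2 * β * (x * y) + γ * y ^ 2 := by
  refine nonneg_of_mul_nonneg_right ?_ htr
  have : (α + γ) * (α * x ^ 2 + 2 * β * (x * y) + γ * y ^ 2)
      = (α * x + β * y) ^ 2 + (β * x + γ * y) ^ 2 + (α * γ - β ^ 2) * (x ^ 2 + y ^ 2) := by ring
  rw [this]
  have := mul_nonneg (sub_nonneg.2 hdet) (by positivity : 0 ≤ x ^ 2 + y ^ 2)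
  positivity

theorem frobNorm_sq_fin_two (W : Matrix (Fin 2) (Fin 2) ℝ) :
    frobNorm W ^ 2 = W 0 0 ^ 2 + W 0 1 ^ 2 + (W 1 0 ^ 2 + W 1 1 ^ 2) := by
  rw [frobNorm, Real.sq_sqrt (by positivity)]
  simp [Fin.sum_univ_two]

/-- A `2 × 2` matrix whose squared singular values have ratio at least `ε` has stable rank at
least `1 + ε`. -/
theorem one_add_le_stableRank {W : Matrix (Fin 2) (Fin 2) ℝ} (hW : W ≠ 0) {ε : ℝ} (hε0 : 0 ≤ ε)
    (hε1 : ε < 1) (hdet : ε * (frobNorm W ^ 2) ^ 2 ≤ (1 + ε) ^ 2 * W.det ^ 2) :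
    1 + ε ≤ stableRank W := by
  have hspec : 0 < specNorm W := by
    rw [specNorm, norm_pos_iff]
    exact fun h => hW ((map_eq_zero_iff _ (Matrix.toEuclideanCLM (n := Fin 2) (𝕜 := ℝ)).injective).1 h)
  have hF : 0 < frobNorm W ^ 2 := by
    rw [frobNorm_sq_fin_two]
    by_contra hcon
    refine hW ?_
    ext i j
    fin_cases i <;> fin_cases j <;> simp <;>
      nlinarith [sq_nonneg (W 0 0), sq_nonneg (W 0 1), sq_nonneg (W 1 0), sq_nonneg (W 1 1)]
  set F := frobNorm W ^ 2 with hFdef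
  have hF' := frobNorm_sq_fin_two W
  rw [← hFdef] at hF'
  rw [Matrix.det_fin_two] at hdet
  set l := F / (1 + ε) with hl
  have hlF : l * (1 + ε) = F := div_mul_cancel₀ _ (by positivity)
  have hl0 : 0 < l := by positivity
  -- It suffices that `l - WᵀW` is positive semidefinite: its trace is `2 l - F > 0` because `ε <
  -- 1`, and its determinant is `det² - ε l² ≥ 0` by `hdet`.
  have hbound : specNorm W ≤ Real.sqrt l := by
    refine ContinuousLinearMap.opNorm_le_bound _ (Real.sqrt_nonneg _) fun v => ?_
    refine abs_le_of_sq_le_sq' ?_ (by positivity) |>.2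
    rw [mul_pow, Real.sq_sqrt hl0.le, EuclideanSpace.real_norm_sq_eq, EuclideanSpace.real_norm_sq_eq]
    simp only [Matrix.ofLp_toEuclideanCLM, Matrix.mulVec, dotProduct, Fin.sum_univ_two]
    have htr : 0 < (l - W 0 0 ^ 2 - W 1 0 ^ 2) + (l - W 0 1 ^ 2 - W 1 1 ^ 2) := by
      have : l * ε < l * 1 := by gcongr
      linarith
    have hq := quadratic_form_nonneg (x := v 0) (y := v 1)
      (β := -(W 0 0 * W 0 1 + W 1 0 * W 1 1)) htr ?_
    · linarith
    · have h1 : ε * l ^ 2 ≤ (W 0 0 * W 1 1 - W 0 1 * W 1 0) ^ 2 := by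
        refine le_of_mul_le_mul_left ?_ (by positivity : 0 < (1 + ε) ^ 2)
        calc (1 + ε) ^ 2 * (ε * l ^ 2) = ε * F ^ 2 := by rw [← hlF]; ring
          _ ≤ _ := hdet
      linear_combination h1 - l * (hlF + hF')
  have hsq : specNorm W ^ 2 ≤ l := by
    calc specNorm W ^ 2 ≤ Real.sqrt l ^ 2 := by gcongr
      _ = l := Real.sq_sqrt hl0.le
  rw [stableRank, le_div_iff₀ (by positivity), ← hFdef, ← hlF, mul_comm l]
  gcongr

/-! ### Antidiagonal symmetry of the post-training flow -/

theorem two_mul_mul_le (k x y : ℝ) : 2 * k * (x * y) ≤ (k ^ 2 + 1) * (x ^ 2 + y ^ 2) / 2 := by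
  have h1 := mul_nonneg (sq_nonneg (k - 1)) (sq_nonneg (x + y))
  have h2 := mul_nonneg (sq_nonneg (k + 1)) (sq_nonneg (x - y))
  linarith

theorem sq_dot_le (p q r s x y z t : ℝ) :
    (p * x + q * y + r * z + s * t) ^ 2
      ≤ (p ^ 2 + q ^ 2 + r ^ 2 + s ^ 2) * (x ^ 2 + y ^ 2 + z ^ 2 + t ^ 2) := by
  linarith [sq_nonneg (p * y - q * x), sq_nonneg (p * z - r * x), sq_nonneg (p * t - s * x),
    sq_nonneg (q * z - r * y), sq_nonneg (q * t - s * y), sq_nonneg (r * t - s * z)]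

section Symmetry

variable {Wstar : Matrix (Fin 2) (Fin 2) ℝ} {w T : ℝ} {A B : ℝ → Matrix (Fin 2) (Fin 2) ℝ}

/-- The post-training flow started from multiples of the identity stays invariant under
exchanging the factors and reflecting them across the antidiagonal. -/
theorem IsGradientFlow.antidiagonal_symm (h00 : Wstar 0 0 = w) (h11 : Wstar 1 1 = w)
    (H : IsGradientFlow postObs Wstar T A B) {α : ℝ}
    (hA : A T = α • (1 : Matrix (Fin 2) (Fin 2) ℝ)) (hB : B T = α • (1 : Matrix (Fin 2) (Fin 2) ℝ))
    {t : ℝ} (ht : T ≤ t) :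
    B t 0 0 = A t 1 1 ∧ B t 0 1 = A t 0 1 ∧ B t 1 0 = A t 1 0 ∧ B t 1 1 = A t 0 0 := by
  have hd := fun s (hs : T ≤ s) => H.deriv_entries_post hs
  simp only [Matrix.mul_apply, Fin.sum_univ_two, h00, h11] at hd
  have cA : ∀ i j, ContinuousOn (fun s => A s i j) (Set.Ici T) := by
    intro i j s hs
    fin_cases i
    · exact ((hd s hs).1 j).continuousWithinAt
    · exact ((hd s hs).2.1 j).continuousWithinAt
  have cB : ∀ i j, ContinuousOn (fun s => B s i j) (Set.Ici T) := by
    intro i j s hs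
    fin_cases j
    · exact ((hd s hs).2.2.1 i).continuousWithinAt
    · exact ((hd s hs).2.2.2 i).continuousWithinAt
  have cA00 := cA 0 0
  have cA01 := cA 0 1
  have cA10 := cA 1 0
  have cA11 := cA 1 1
  have cB00 := cB 0 0
  have cB01 := cB 0 1
  have cB10 := cB 1 0
  have cB11 := cB 1 1
  have key : 0 ≤ -((A t 0 0 - B t 1 1) ^ 2 + (A t 1 1 - B t 0 0) ^ 2 + (A t 0 1 - B t 0 1) ^ 2
      + (A t 1 0 - B t 1 0) ^ 2) := by
    -- Grönwall for the squared distance to the symmetric subspace: its derivative is quadratic in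
    -- the differences `δᵢ`, and `g` is a continuous coefficient dominating it. Here `τ` is the sum
    -- of the diagonal residuals, while `ρ` and `π` are, up to sign, the gap between them, written
    -- linearly in the `δᵢ`.
    refine nonneg_of_hasDerivWithinAt (T := T)
      (f := fun t => -((A t 0 0 - B t 1 1) ^ 2 + (A t 1 1 - B t 0 0) ^ 2 + (A t 0 1 - B t 0 1) ^ 2
        + (A t 1 0 - B t 1 0) ^ 2))
      (g := fun t =>
        ((A t 0 0 * B t 0 1 + A t 0 1 * B t 1 1 - Wstar 0 1) ^ 2 + 1) * 2
        + ((A t 0 0 * B t 0 0 + A t 0 1 * B t 1 0 - w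
          + (A t 1 0 * B t 0 1 + A t 1 1 * B t 1 1 - w)) ^ 2 + 1)
        + (A t 0 0 ^ 2 + A t 0 1 ^ 2 + A t 1 0 ^ 2 + A t 1 1 ^ 2
          + B t 0 0 ^ 2 + B t 0 1 ^ 2 + B t 1 0 ^ 2 + B t 1 1 ^ 2))
      (h := fun t =>
        let δ₁ := A t 0 0 - B t 1 1
        let δ₂ := A t 1 1 - B t 0 0
        let δ₃ := A t 0 1 - B t 0 1
        let δ₄ := A t 1 0 - B t 1 0
        let σ := A t 0 0 * B t 0 1 + A t 0 1 * B t 1 1 - Wstar 0 1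
        let τ := A t 0 0 * B t 0 0 + A t 0 1 * B t 1 0 - w
          + (A t 1 0 * B t 0 1 + A t 1 1 * B t 1 1 - w)
        let ρ := -A t 1 1 * δ₁ + A t 0 0 * δ₂ - A t 1 0 * δ₃ + A t 0 1 * δ₄
        let π := B t 0 0 * δ₁ - B t 1 1 * δ₂ + B t 1 0 * δ₃ - B t 0 1 * δ₄
        ((σ ^ 2 + 1) * 2 + (τ ^ 2 + 1)
          + (A t 0 0 ^ 2 + A t 0 1 ^ 2 + A t 1 0 ^ 2 + A t 1 1 ^ 2
          + B t 0 0 ^ 2 + B t 0 1 ^ 2 + B t 1 0 ^ 2 + B t 1 1 ^ 2))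
          * (δ₁ ^ 2 + δ₂ ^ 2 + δ₃ ^ 2 + δ₄ ^ 2)
          - (4 * σ * (δ₁ * δ₃) + 2 * τ * (δ₁ * δ₂ + δ₃ * δ₄) + 2 * ρ * π)) ht
      (ContinuousOn.mono (by fun_prop) Set.Icc_subset_Ici_self) (fun s hs => ?_) (fun s _ => ?_)
      (by simp [hA, hB])
    · obtain ⟨d0, d1, e0, e1⟩ := hd s hs.1
      refine ((((((d0 0).fun_sub (e1 1)).fun_pow 2).fun_add
        (((d1 1).fun_sub (e0 0)).fun_pow 2)).fun_add
        (((d0 1).fun_sub (e1 0)).fun_pow 2)).fun_add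
        (((d1 0).fun_sub (e0 1)).fun_pow 2)).fun_neg.congr_deriv ?_
      norm_num
      ring
    · extract_lets δ₁ δ₂ δ₃ δ₄ σ τ ρ π
      have h1 : 4 * σ * (δ₁ * δ₃) ≤ (σ ^ 2 + 1) * 2 * (δ₁ ^ 2 + δ₂ ^ 2 + δ₃ ^ 2 + δ₄ ^ 2) := by
        linarith [two_mul_mul_le σ δ₁ δ₃, mul_nonneg (by positivity : 0 ≤ σ ^ 2 + 1)
          (by positivity : 0 ≤ δ₁ ^ 2 + 2 * δ₂ ^ 2 + δ₃ ^ 2 + 2 * δ₄ ^ 2)]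
      have h2 : 2 * τ * (δ₁ * δ₂ + δ₃ * δ₄)
          ≤ (τ ^ 2 + 1) * (δ₁ ^ 2 + δ₂ ^ 2 + δ₃ ^ 2 + δ₄ ^ 2) := by
        linarith [two_mul_mul_le τ δ₁ δ₂, two_mul_mul_le τ δ₃ δ₄, mul_nonneg
          (by positivity : 0 ≤ τ ^ 2 + 1) (by positivity : 0 ≤ δ₁ ^ 2 + δ₂ ^ 2 + δ₃ ^ 2 + δ₄ ^ 2)]
      have h3 : ρ ^ 2 ≤ (A s 0 0 ^ 2 + A s 0 1 ^ 2 + A s 1 0 ^ 2 + A s 1 1 ^ 2)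
          * (δ₁ ^ 2 + δ₂ ^ 2 + δ₃ ^ 2 + δ₄ ^ 2) := by
        linarith [sq_dot_le (-A s 1 1) (A s 0 0) (-A s 1 0) (A s 0 1) δ₁ δ₂ δ₃ δ₄]
      have h4 : π ^ 2 ≤ (B s 0 0 ^ 2 + B s 0 1 ^ 2 + B s 1 0 ^ 2 + B s 1 1 ^ 2)
          * (δ₁ ^ 2 + δ₂ ^ 2 + δ₃ ^ 2 + δ₄ ^ 2) := by
        linarith [sq_dot_le (B s 0 0) (-B s 1 1) (B s 1 0) (-B s 0 1) δ₁ δ₂ δ₃ δ₄]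
      linarith [two_mul_le_add_sq ρ π]
  have p1 := sq_nonneg (A t 0 0 - B t 1 1)
  have p2 := sq_nonneg (A t 1 1 - B t 0 0)
  have p3 := sq_nonneg (A t 0 1 - B t 0 1)
  have p4 := sq_nonneg (A t 1 0 - B t 1 0)
  have z1 := pow_eq_zero_iff two_ne_zero |>.1 (le_antisymm (by linarith) p1)
  have z2 := pow_eq_zero_iff two_ne_zero |>.1 (le_antisymm (by linarith) p2)
  have z3 := pow_eq_zero_iff two_ne_zero |>.1 (le_antisymm (by linarith) p3)
  have z4 := pow_eq_zero_iff two_ne_zero |>.1 (le_antisymm (by linarith) p4)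
  exact ⟨by linarith, by linarith, by linarith, by linarith⟩

theorem IsGradientFlow.isSymmetricFlow (h00 : Wstar 0 0 = w) (h11 : Wstar 1 1 = w)
    (H : IsGradientFlow postObs Wstar T A B)
    (hA : A T = Real.sqrt w • (1 : Matrix (Fin 2) (Fin 2) ℝ))
    (hB : B T = Real.sqrt w • (1 : Matrix (Fin 2) (Fin 2) ℝ)) :
    IsSymmetricFlow w (Wstar 0 1) T (fun t => A t 0 0) (fun t => A t 0 1) (fun t => A t 1 0)
      (fun t => A t 1 1) := by
  have hd := fun s (hs : T ≤ s) => H.deriv_entries_post hs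
  simp only [Matrix.mul_apply, Fin.sum_univ_two, h00, h11] at hd
  refine ⟨fun t ht => ((hd t ht).1 0).congr_deriv ?_, fun t ht => ((hd t ht).1 1).congr_deriv ?_,
    fun t ht => ((hd t ht).2.1 0).congr_deriv ?_, fun t ht => ((hd t ht).2.1 1).congr_deriv ?_,
    by simp [hA], by simp [hA], by simp [hA], by simp [hA]⟩ <;>
  · obtain ⟨e0, e1, e2, e3⟩ := H.antidiagonal_symm h00 h11 hA hB ht
    simp only [e0, e1, e2, e3]
    ring

end Symmetry

end MatrixCompletion

/-! ### The main theorem -/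

theorem theorem4p2 (Wstar : Matrix (Fin 2) (Fin 2) ℝ) (w w12 : ℝ) (hw : 0 < w) (hw12 : 0 < w12)
    (h11 : Wstar 0 0 = w) (h22 : Wstar 1 1 = w) (h12 : Wstar 0 1 = w12) :
    -- pre-training on the diagonal from a multiple of the identity
    (∀ (α : ℝ), 0 < α → ∀ (A B : ℝ → Matrix (Fin 2) (Fin 2) ℝ),
      MatrixCompletion.IsGradientFlow MatrixCompletion.preObs Wstar 0 A B →
      A 0 = α • (1 : Matrix (Fin 2) (Fin 2) ℝ) → B 0 = α • (1 : Matrix (Fin 2) (Fin 2) ℝ) →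
        Tendsto A atTop (𝓝 (Real.sqrt w • (1 : Matrix (Fin 2) (Fin 2) ℝ))) ∧
        Tendsto B atTop (𝓝 (Real.sqrt w • (1 : Matrix (Fin 2) (Fin 2) ℝ)))) ∧
    -- post-training from the pre-trained factors
    (∀ (T₁ : ℝ) (A B : ℝ → Matrix (Fin 2) (Fin 2) ℝ),
      MatrixCompletion.IsGradientFlow MatrixCompletion.postObs Wstar T₁ A B →
      A T₁ = Real.sqrt w • (1 : Matrix (Fin 2) (Fin 2) ℝ) →
      B T₁ = Real.sqrt w • (1 : Matrix (Fin 2) (Fin 2) ℝ) →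
        (∀ t, T₁ ≤ t → MatrixCompletion.loss MatrixCompletion.postObs Wstar (A t * B t) ≤
          (1 / 2) * w12 ^ 2 * Real.exp (-2 * w * (t - T₁))) ∧
        (∃ Winf : Matrix (Fin 2) (Fin 2) ℝ,
          Tendsto (fun t => A t * B t) atTop (𝓝 Winf) ∧
          1 + Real.exp (-8 * (w12 / w)) ≤ MatrixCompletion.stableRank Winf) ∧
        (∀ t, T₁ < t → (A t * B t) 1 0 < 0)) := by
  refine ⟨fun α hα A B H hA hB => H.tendsto_pre hw (fun i => by fin_cases i <;> simp [h11, h22])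
    hα hA hB, fun T₁ A B H hA hB => ?_⟩
  have hS := H.isSymmetricFlow h11 h22 hA hB
  rw [h12] at hS
  have hW : ∀ t, T₁ ≤ t →
      (A t * B t) 0 0 = A t 0 0 * A t 1 1 + A t 0 1 * A t 1 0 ∧
      (A t * B t) 0 1 = 2 * A t 0 0 * A t 0 1 ∧
      (A t * B t) 1 0 = 2 * A t 1 0 * A t 1 1 ∧
      (A t * B t) 1 1 = A t 0 0 * A t 1 1 + A t 0 1 * A t 1 0 := by
    intro t ht
    obtain ⟨e0, e1, e2, e3⟩ := H.antidiagonal_symm h11 h22 hA hB ht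
    simp only [Matrix.mul_apply, Fin.sum_univ_two, e0, e1, e2, e3]
    refine ⟨trivial, ?_, ?_, ?_⟩ <;> ring
  refine ⟨fun t ht => ?_, ?_, fun t ht => ?_⟩
  · obtain ⟨e0, e1, e2, e3⟩ := hW t ht
    have := hS.residual_sq_le hw hw12 ht
    simp only [MatrixCompletion.loss, MatrixCompletion.postObs]
    rw [Finset.sum_insert (by decide), Finset.sum_insert (by decide), Finset.sum_singleton]
    simp only [e0, e1, e3, h11, h12, h22]
    linarith
  · obtain ⟨l, hl⟩ := hS.exists_tendsto_unobserved hw hw12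
    obtain ⟨hr, hs⟩ := hS.tendsto_residual hw hw12
    have hdiag : Tendsto (fun t => A t 0 0 * A t 1 1 + A t 0 1 * A t 1 0) atTop (𝓝 w) := by
      simpa using hr.add_const w
    have hoff : Tendsto (fun t => 2 * A t 0 0 * A t 0 1) atTop (𝓝 w12) := by
      simpa using hs.neg.add_const w12
    have hlim : Tendsto (fun t => A t * B t) atTop (𝓝 !![w, w12; l, w]) := by
      refine tendsto_pi_nhds.2 fun i => tendsto_pi_nhds.2 fun j => ?_
      fin_cases i <;> fin_cases j
      · exact hdiag.congr' ((eventually_ge_atTop T₁).mono fun t ht => (hW t ht).1.symm)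
      · exact hoff.congr' ((eventually_ge_atTop T₁).mono fun t ht => (hW t ht).2.1.symm)
      · exact hl.congr' ((eventually_ge_atTop T₁).mono fun t ht => (hW t ht).2.2.1.symm)
      · exact hdiag.congr' ((eventually_ge_atTop T₁).mono fun t ht => (hW t ht).2.2.2.symm)
    refine ⟨_, hlim, ?_⟩
    set N := Real.exp (w12 / w) with hN
    have hN0 : 0 < N := Real.exp_pos _
    have hN1 : 1 < N := Real.one_lt_exp_iff.2 (by positivity)
    have hsum : (w12 + l) ^ 2 ≤ (w ^ 2 - w12 * l) * (N - N⁻¹) ^ 2 := by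
      refine le_of_tendsto_of_tendsto ((hoff.add hl).pow 2)
        (((hdiag.pow 2).sub (hoff.mul hl)).mul_const _) ?_
      filter_upwards [eventually_ge_atTop T₁] with t ht
      refine (hS.antidiag_sum_le hw hw12 ht).trans_eq ?_
      rw [← hN]
      ring
    -- The argument gives the stronger exponent `-4 w12 / w`; the stated `-8` is a weakening.
    have hε : Real.exp (-8 * (w12 / w)) ≤ (N⁻¹) ^ 4 := by
      rw [hN, ← Real.exp_neg, ← Real.exp_nat_mul]
      have : 0 < w12 / w := by positivity
      refine Real.exp_le_exp.2 ?_
      push_cast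
      linarith
    have hNi1 : N⁻¹ < 1 := inv_lt_one_of_one_lt₀ hN1
    have hNN : N * N⁻¹ = 1 := mul_inv_cancel₀ hN0.ne'
    refine (add_le_add_right hε 1).trans (MatrixCompletion.one_add_le_stableRank (fun h0 => ?_)
      (by positivity) (pow_lt_one₀ (by positivity) hNi1 four_ne_zero) ?_)
    · exact hw.ne' (congrFun (congrFun h0 0) 0)
    · rw [MatrixCompletion.frobNorm_sq_fin_two, Matrix.det_fin_two]
      simp only [Matrix.of_apply, Matrix.cons_val', Matrix.cons_val_zero, Matrix.cons_val_one,
        Matrix.cons_val_fin_one]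
      -- The squared Frobenius norm is `(w12 + l)² + 2 det`, and `(N - N⁻¹)² + 2 = N² + N⁻²`. This
      -- bounds the singular value ratio of the limit by `N²`.
      have hF : w ^ 2 + w12 ^ 2 + (l ^ 2 + w ^ 2) ≤ (w * w - w12 * l) * (N ^ 2 + (N⁻¹) ^ 2) := by
        linear_combination hsum - 2 * (w ^ 2 - w12 * l) * hNN
      calc (N⁻¹) ^ 4 * (w ^ 2 + w12 ^ 2 + (l ^ 2 + w ^ 2)) ^ 2
          ≤ (N⁻¹) ^ 4 * ((w * w - w12 * l) * (N ^ 2 + (N⁻¹) ^ 2)) ^ 2 := by gcongr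
        _ = (1 + (N⁻¹) ^ 4) ^ 2 * (w * w - w12 * l) ^ 2 := by
          field_simp
  · rw [(hW t ht.le).2.2.1]
    exact hS.unobserved_neg hw hw12 ht
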